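/- Let $\mathfrak F$ be a free filter on $\mathbb N$, i.e. a family of subsets of $\mathbb N$ that does not contain $\emptyset$, is closed under finite intersections and supersets, and contains every set with finite complement. A sequence $(x_n)$ in a Banach space is $\mathfrak F$-convergent to $x$, written $x=\mathfrak F\text{-}\lim_n x_n$, if $\{n : x_n\in U\}\in\mathfrak F$ for every neighbourhood $U$ of $x$. A set $I\subset\mathbb N$ is $\mathfrak F$-stationary if $I\cap A\neq\emptyset$ for every $A\in\mathfrak F$. A sequence $(a_n)$ of positive reals is $(\mathfrak F,1)$-admissible if $\sum_{n\in I}a_n^{-1}=\infty$ for every $\mathfrak F$-stationary set $I$. A sequence $(u_n)$ in a real Banach space $X$ is an $\mathfrak F$-basis of $X$ if for every $x\in X$ there is a unique sequence of scalars $(c_n)$ such that $\mathfrak F\text{-}\lim_n\sum_{k=1}^n c_k u_k=x$; its partial sums operators are the maps $S_n\colon X\to X$, $S_n(x)=\sum_{k=1}^n c_k u_k$. Theorem. Let $\mathfrak F$ be a free filter on $\mathbb N$ and let $(a_n)_{n\in\mathbb N}\subset(1,\infty)$. The following conditions are equivalent: (i) there is an $\mathfrak F$-basis of the real space $\ell_1$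 whose partial sums operators $S_n$ are all continuous and satisfy $\|S_n\|=a_n$ for every $n$; (ii) there are an infinite-dimensional real Banach space $X$ and an $\mathfrak F$-basis of $X$ whose partial sums operators $S_n$ are all continuous and satisfy $\|S_n\|=a_n$ for every $n$; (iii) the sequence $(a_n)$ is $(\mathfrak F,1)$-admissible. -/

import Mathlib

open Filter Topology

universe u

/-- A filter on `ℕ` is free if it is proper and contains the Fréchet filter of cofinite sets
(in Mathlib's order on filters, `F ≤ cofinite` says that every cofinite set belongs to `F`). -/
def IsFreeFilter (F : Filter ℕ) : Prop :=
  F.NeBot ∧ F ≤ cofinite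

/-- `I` is `F`-stationary if it meets every member of `F`. -/
def IsStationaryFor (F : Filter ℕ) (I : Set ℕ) : Prop :=
  ∀ A ∈ F, (I ∩ A).Nonempty

/-- `(F, p)`-admissible sequences of positive reals: `∑_{n ∈ I} a_n ^ (-p) = ∞` for every
`F`-stationary set `I`. The sum of positive terms is taken in `[0, ∞]`. -/
def IsAdmissible (F : Filter ℕ) (p : ℝ) (a : ℕ → ℝ) : Prop :=
  (∀ n, 0 < a n) ∧
    ∀ I : Set ℕ, IsStationaryFor F I → ∑' n : I, ENNReal.ofReal (a n ^ (-p)) = ⊤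

section FBasis

variable {X : Type*} [NormedAddCommGroup X] [NormedSpace ℝ X]

/-- `e` is an `F`-basis of `X`: every `x` is the `F`-limit of the partial sums
`∑_{k ≤ n} c_k e_k` for exactly one sequence of scalars `c`. Sequences are indexed from `0`, so
the `n`-th partial sum has the `n + 1` terms with indices `0, …, n`. -/
def IsFBasis (F : Filter ℕ) (e : ℕ → X) : Prop :=
  ∀ x : X, ∃! c : ℕ → ℝ, Tendsto (fun n => ∑ k ∈ Finset.range (n + 1), c k • e k) F (𝓝 x)

/-- The coordinate functionals of an `F`-basis. -/
noncomputable def IsFBasis.coord {F : Filter ℕ} {e : ℕ → X} (he : IsFBasis F e)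
    (k : ℕ) (x : X) : ℝ :=
  (he x).choose k

/-- The partial sums operators `S_n` of an `F`-basis. -/
noncomputable def IsFBasis.partialSum {F : Filter ℕ} {e : ℕ → X} (he : IsFBasis F e)
    (n : ℕ) (x : X) : X :=
  ∑ k ∈ Finset.range (n + 1), he.coord k x • e k

/-- Each partial sums operator `S_n` is a continuous linear operator, of operator norm `a n`. -/
def IsFBasis.HasPartialSumNorms {F : Filter ℕ} {e : ℕ → X} (he : IsFBasis F e)
    (a : ℕ → ℝ) : Prop :=
  ∀ n, ∃ S : X →L[ℝ] X, (∀ x, S x = he.partialSum n x) ∧ ‖S‖ = a n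

end FBasis

/-! From (iii) to (i): perturb the unit vector basis δ of ℓ₁ by e₀ = δ₀, eₙ₊₁ = δₙ₊₁ - αₙeₙ with αₙ
= aₙ/‖eₙ‖. The partial sums telescope to Sₙx = ∑_{k≤n} xₖδₖ + αₙxₙ₊₁eₙ. The boundary term has norm
aₙ|xₙ₊₁|, which tends to 0 along the filter by admissibility; it also forces ‖Sₙ‖ = aₙ, since aₙ ≥
1.

From (ii) to (iii): suppose ∑ 1/aₙ converges on a stationary set. Off finitely many indices ‖Sₙ -
id‖ ≥ aₙ/2, so ∑ 1/‖Sₙ - id‖ converges there. A plank theorem in the style of Ball then yields one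
vector y with ‖Sₙy - y‖ ≥ δ > 0 at all these indices, contradicting Sₙy → y along the filter.
Completeness of the space is used in the plank theorem. -/

/-- Where aₙ|cₙ| ≥ ε, one has 1/aₙ ≤ |cₙ|/ε, which is summable; so that set cannot be stationary. -/
theorem IsAdmissible.tendsto_mul {F : Filter ℕ} {a : ℕ → ℝ} (ha : IsAdmissible F 1 a)
    {c : ℕ → ℝ} (hc : Summable fun n => |c n|) :
    Tendsto (fun n => a n * |c n|) F (𝓝 0) := by
  rw [Metric.tendsto_nhds]
  intro ε hε
  by_contra hcon
  have hst : IsStationaryFor F {n | ε ≤ a n * |c n|} := by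
    intro A hA
    by_contra hne
    apply hcon
    filter_upwards [hA] with n hn
    have hlt : ¬ ε ≤ a n * |c n| := fun h => hne ⟨n, h, hn⟩
    rw [Real.dist_eq, sub_zero, abs_of_nonneg (mul_nonneg (ha.1 n).le (abs_nonneg _))]
    exact not_le.1 hlt
  have hsum := ha.2 _ hst
  have hs : Summable fun n : {n | ε ≤ a n * |c n|} => |c n| / ε :=
    (hc.subtype _).div_const ε
  refine hs.tsum_ofReal_ne_top (top_unique (hsum ▸ ENNReal.tsum_le_tsum fun n => ?_))
  refine ENNReal.ofReal_le_ofReal ?_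
  rw [Real.rpow_neg_one, inv_eq_one_div, div_le_div_iff₀ (ha.1 n) hε, one_mul, mul_comm]
  exact n.2

/-! ### Uniqueness of coordinates and transport along isometries -/

section Unique

variable {X : Type*} [NormedAddCommGroup X] [NormedSpace ℝ X] {F : Filter ℕ} {e : ℕ → X}

theorem IsFBasis.coord_eq (he : IsFBasis F e) {x : X} {c : ℕ → ℝ}
    (hc : Tendsto (fun n => ∑ k ∈ Finset.range (n + 1), c k • e k) F (𝓝 x)) (k : ℕ) :
    he.coord k x = c k :=
  congrFun ((he x).unique (he x).choose_spec.1 hc) k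

theorem IsFBasis.tendsto_partialSum (he : IsFBasis F e) (x : X) :
    Tendsto (fun n => he.partialSum n x) F (𝓝 x) :=
  (he x).choose_spec.1

/-- Being an `F`-basis with prescribed norms of partial sums is invariant under isometries. -/
theorem IsFBasis.exists_map_hasPartialSumNorms {Y : Type*} [NormedAddCommGroup Y]
    [NormedSpace ℝ Y] (he : IsFBasis F e) {a : ℕ → ℝ} (hn : he.HasPartialSumNorms a)
    (L : X ≃ₗᵢ[ℝ] Y) :
    ∃ (f : ℕ → Y) (hf : IsFBasis F f), hf.HasPartialSumNorms a := by
  have key : ∀ (c : ℕ → ℝ) (y : Y),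
      Tendsto (fun n => ∑ k ∈ Finset.range (n + 1), c k • L (e k)) F (𝓝 y) ↔
      Tendsto (fun n => ∑ k ∈ Finset.range (n + 1), c k • e k) F (𝓝 (L.symm y)) := by
    intro c y
    rw [L.symm.toHomeomorph.isEmbedding.tendsto_nhds_iff]
    refine iff_of_eq (congrArg (Tendsto · F _) (funext fun n => ?_))
    simp
  have hf : IsFBasis F (fun k => L (e k)) := fun y => by
    obtain ⟨c, hc, hu⟩ := he (L.symm y)
    exact ⟨c, (key c y).2 hc, fun d hd => hu d ((key d y).1 hd)⟩
  refine ⟨_, hf, fun n => ?_⟩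
  obtain ⟨S, hS, hSn⟩ := hn n
  refine ⟨(L.toContinuousLinearEquiv : X →L[ℝ] Y) ∘L S ∘L
    (L.symm.toContinuousLinearEquiv : Y →L[ℝ] X), fun y => ?_, ?_⟩
  · have : ∀ k, hf.coord k y = he.coord k (L.symm y) := fun k =>
      hf.coord_eq ((key _ y).2 (he.tendsto_partialSum _)) k
    simp [hS, IsFBasis.partialSum, this]
  · rw [← hSn]
    have h1 : ‖(L.toContinuousLinearEquiv : X →L[ℝ] Y) ∘L S ∘L
        (L.symm.toContinuousLinearEquiv : Y →L[ℝ] X)‖ =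
        ‖S ∘L (L.symm.toContinuousLinearEquiv : Y →L[ℝ] X)‖ :=
      L.toLinearIsometry.norm_toContinuousLinearMap_comp
    rw [h1]
    exact ContinuousLinearMap.opNorm_comp_linearIsometryEquiv S L.symm

end Unique

/-! ### The basis of ℓ₁ with prescribed norms -/

/-- The sequence `δ 0, δ 1 - α 0 • e 0, δ 2 - α 1 • e 1, …` in `ℓ¹`, where `α n = a n / ‖e n‖`. -/
noncomputable def bidiagonal (a : ℕ → ℝ) : ℕ → lp (fun _ : ℕ => ℝ) 1
  | 0 => lp.single 1 0 1
  | n + 1 => lp.single 1 (n + 1) 1 - (a n / ‖bidiagonal a n‖) • bidiagonal a n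

theorem bidiagonal_succ_apply (a : ℕ → ℝ) (n k : ℕ) :
    bidiagonal a (n + 1) k =
      lp.single (E := fun _ : ℕ => ℝ) 1 (n + 1) 1 k - a n / ‖bidiagonal a n‖ * bidiagonal a n k :=
  rfl

theorem bidiagonal_apply_of_lt (a : ℕ → ℝ) : ∀ {n k : ℕ}, n < k → bidiagonal a n k = 0
  | 0, k, h => by simp [bidiagonal, lp.single_apply, h.ne']
  | n + 1, k, h => by
    simp [bidiagonal_succ_apply, lp.single_apply, h.ne',
      bidiagonal_apply_of_lt a (Nat.lt_of_succ_lt h)]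

theorem bidiagonal_ne_zero (a : ℕ → ℝ) (n : ℕ) : bidiagonal a n ≠ 0 := by
  have h : bidiagonal a n n = 1 := by
    cases n with
    | zero => simp [bidiagonal, lp.single_apply]
    | succ n => 
      simp [bidiagonal_succ_apply, lp.single_apply,
        bidiagonal_apply_of_lt a (Nat.lt_succ_self n)]
  intro h0
  simp [h0] at h

/-- The functionals biorthogonal to `bidiagonal a`. -/
noncomputable def bidiagonalCoord (a : ℕ → ℝ) (k : ℕ) : lp (fun _ : ℕ => ℝ) 1 →L[ℝ] ℝ :=
  lp.evalCLM ℝ (fun _ => ℝ) 1 k +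
    (a k / ‖bidiagonal a k‖) • lp.evalCLM ℝ (fun _ => ℝ) 1 (k + 1)

theorem bidiagonalCoord_apply (a : ℕ → ℝ) (k : ℕ) (x : lp (fun _ : ℕ => ℝ) 1) :
    bidiagonalCoord a k x = x k + a k / ‖bidiagonal a k‖ * x (k + 1) := rfl

theorem bidiagonalCoord_bidiagonal (a : ℕ → ℝ) (k : ℕ) : ∀ n,
    bidiagonalCoord a k (bidiagonal a n) = if n = k then 1 else 0
  | 0 => by
    simp [bidiagonalCoord_apply, bidiagonal, lp.single_apply, Pi.single_apply, eq_comm]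
  | n + 1 => by
    rw [bidiagonal, map_sub, map_smul, bidiagonalCoord_bidiagonal a k n]
    by_cases h : n = k
    · subst h
      simp [bidiagonalCoord_apply, lp.single_apply]
    · simp [bidiagonalCoord_apply, lp.single_apply, Pi.single_apply, h, Ne.symm h, eq_comm]

/-- Telescoping: by the recursion, each new summand cancels the previous boundary term, and only the
last one survives. -/
theorem sum_bidiagonalCoord_smul (a : ℕ → ℝ) (x : lp (fun _ : ℕ => ℝ) 1) (n : ℕ) :
    ∑ k ∈ Finset.range (n + 1), bidiagonalCoord a k x • bidiagonal a k =
      ∑ k ∈ Finset.range (n + 1), lp.single 1 k (x k) +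
        (a n / ‖bidiagonal a n‖ * x (n + 1)) • bidiagonal a n := by
  have hs : ∀ k, lp.single (E := fun _ : ℕ => ℝ) 1 k (x k) = x k • lp.single 1 k (1 : ℝ) :=
    fun k => by rw [← lp.single_smul]; simp
  induction n with
  | zero => simp [bidiagonalCoord_apply, add_smul, hs, bidiagonal]
  | succ n ih =>
    rw [Finset.sum_range_succ, ih, Finset.sum_range_succ _ (n + 1), bidiagonalCoord_apply, add_smul,
      hs (n + 1)]
    have h : bidiagonal a (n + 1) =
      lp.single 1 (n + 1) 1 - (a n / ‖bidiagonal a n‖) • bidiagonal a n := rfl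
    have h' : x (n + 1) • bidiagonal a (n + 1) + (a n / ‖bidiagonal a n‖ * x (n + 1)) •
        bidiagonal a n = x (n + 1) • lp.single 1 (n + 1) (1 : ℝ) := by
      rw [h, smul_sub, smul_smul, mul_comm (x _) (a n / _), sub_add_cancel]
    rw [← h']
    abel

theorem lp_one_summable_abs (x : lp (fun _ : ℕ => ℝ) 1) : Summable fun n => |x n| := by
  simpa using (lp.hasSum_norm (p := 1) (by simp) x).summable

theorem lp_one_sum_abs_le (x : lp (fun _ : ℕ => ℝ) 1) (s : Finset ℕ) :
    ∑ n ∈ s, |x n| ≤ ‖x‖ := by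
  simpa using lp.sum_rpow_le_norm_rpow (p := 1) (by simp) x s

theorem tendsto_sum_bidiagonalCoord_smul {F : Filter ℕ} (hF : IsFreeFilter F) {a : ℕ → ℝ}
    (ha : IsAdmissible F 1 a) (x : lp (fun _ : ℕ => ℝ) 1) :
    Tendsto (fun n => ∑ k ∈ Finset.range (n + 1), bidiagonalCoord a k x • bidiagonal a k) F
      (𝓝 x) := by
  simp only [sum_bidiagonalCoord_smul]
  have h1 : Tendsto (fun n => ∑ k ∈ Finset.range (n + 1), lp.single 1 k (x k)) F (𝓝 x) :=
    (((lp.hasSum_single (by simp) x).tendsto_sum_nat.comp (tendsto_add_atTop_nat 1))).mono_left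
      (hF.2.trans Nat.cofinite_eq_atTop.le)
  have h2 : Tendsto (fun n => (a n / ‖bidiagonal a n‖ * x (n + 1)) • bidiagonal a n) F
      (𝓝 0) := by
    rw [tendsto_zero_iff_norm_tendsto_zero]
    refine (ha.tendsto_mul ((summable_nat_add_iff 1).2 (lp_one_summable_abs x))).congr
      fun n => ?_
    have := norm_ne_zero_iff.2 (bidiagonal_ne_zero a n)
    rw [norm_smul, norm_mul, norm_div, norm_norm, Real.norm_eq_abs, Real.norm_eq_abs,
      abs_of_pos (ha.1 n)]
    field_simp
  simpa using h1.add h2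

theorem isFBasis_bidiagonal {F : Filter ℕ} (hF : IsFreeFilter F) {a : ℕ → ℝ}
    (ha : IsAdmissible F 1 a) : IsFBasis F (bidiagonal a) := by
  have := hF.1
  refine fun x => ⟨_, tendsto_sum_bidiagonalCoord_smul hF ha x, fun c hc => funext fun j => ?_⟩
  -- By biorthogonality, the `j`-th functional takes the value `c j` on every partial sum with `n ≥
  -- j`; continuity determines `c j`.
  have h := ((bidiagonalCoord a j).continuous.tendsto x).comp hc
  refine tendsto_nhds_unique (tendsto_const_nhds.congr' ?_) h
  filter_upwards [hF.2 (Nat.cofinite_eq_atTop ▸ eventually_ge_atTop j)] with n hn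
  simp [bidiagonalCoord_bidiagonal, Nat.lt_succ_of_le hn]

theorem hasPartialSumNorms_bidiagonal {F : Filter ℕ} (hF : IsFreeFilter F) {a : ℕ → ℝ}
    (ha : IsAdmissible F 1 a) (h1 : ∀ n, 1 ≤ a n) :
    (isFBasis_bidiagonal hF ha).HasPartialSumNorms a := by
  intro n
  set he := isFBasis_bidiagonal hF ha
  have hcoord : ∀ x k, he.coord k x = bidiagonalCoord a k x := fun x =>
    he.coord_eq (tendsto_sum_bidiagonalCoord_smul hF ha x)
  have hb := norm_ne_zero_iff.2 (bidiagonal_ne_zero a n)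
  set S : lp (fun _ : ℕ => ℝ) 1 →L[ℝ] lp (fun _ : ℕ => ℝ) 1 :=
    ∑ k ∈ Finset.range (n + 1), (bidiagonalCoord a k).smulRight (bidiagonal a k) with hSdef
  have hS : ∀ x, S x = ∑ k ∈ Finset.range (n + 1), lp.single 1 k (x k) +
        (a n / ‖bidiagonal a n‖ * x (n + 1)) • bidiagonal a n := fun x => by
    rw [← sum_bidiagonalCoord_smul, hSdef]
    simp
  have hnorm : ∀ t : ℝ, ‖(a n / ‖bidiagonal a n‖ * t) • bidiagonal a n‖ = a n * |t| := fun t => by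
    rw [norm_smul, norm_mul, norm_div, norm_norm, Real.norm_eq_abs, Real.norm_eq_abs,
        abs_of_pos (ha.1 n)]
    field_simp
  refine ⟨S, fun x => ?_, le_antisymm ?_ ?_⟩
  · simp [hSdef, IsFBasis.partialSum, hcoord]
  · refine S.opNorm_le_bound (ha.1 n).le fun x => ?_
    calc ‖S x‖ ≤ ∑ k ∈ Finset.range (n + 1), |x k| + a n * |x (n + 1)| := by
          rw [hS]
          refine (norm_add_le _ _).trans (add_le_add ((norm_sum_le _ _).trans_eq ?_) (hnorm _).le)
          exact Finset.sum_congr rfl fun k _ => by rw [lp.norm_single one_pos, Real.norm_eq_abs]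
      _ ≤ a n * ∑ k ∈ Finset.range (n + 1), |x k| + a n * |x (n + 1)| := by
          gcongr
          exact le_mul_of_one_le_left (Finset.sum_nonneg fun _ _ => abs_nonneg _) (h1 n)
      _ = a n * ∑ k ∈ Finset.range (n + 1 + 1), |x k| := by
          rw [Finset.sum_range_succ _ (n + 1), mul_add]
      _ ≤ a n * ‖x‖ := by
          gcongr
          · exact (ha.1 n).le
          · exact lp_one_sum_abs_le x _
  -- The norm is attained at the unit vector `n + 1`, where only the boundary term remains.
  · have h := S.le_opNorm (lp.single 1 (n + 1) (1 : ℝ))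
    rw [hS, lp.norm_single one_pos, Finset.sum_eq_zero, zero_add, hnorm] at h
    · simpa using h
    · intro k hk
      have : k ≠ n + 1 := (Finset.mem_range.1 hk).ne
      rw [lp.single_apply, Pi.single_eq_of_ne this, lp.single_zero]

/-! ### Plank theorems -/

open scoped Matrix in
/-- **Bang's lemma**: signs maximizing the quadratic form of a symmetric matrix. -/
theorem Matrix.IsSymm.exists_signs_diag_le {ι : Type*} [Fintype ι] {M : Matrix ι ι ℝ}
    (hM : M.IsSymm) :
    ∃ ε : ι → ℝ, (∀ i, ε i ^ 2 = 1) ∧ ∀ i, M i i ≤ ε i * ∑ j, M i j * ε j := by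
  classical
  have hfin : {ε : ι → ℝ | ∀ i, ε i ∈ ({1, -1} : Set ℝ)}.Finite :=
    Set.Finite.pi' fun _ => Set.toFinite _
  obtain ⟨ε, hε, hmax⟩ := Set.exists_max_image _ (fun x => x ⬝ᵥ (M *ᵥ x)) hfin
    ⟨fun _ => 1, fun _ => by simp⟩
  have hsq : ∀ i, ε i ^ 2 = 1 := fun i => by
    rcases hε i with h | h
    · simp [h]
    · simp [Set.mem_singleton_iff.1 h]
  refine ⟨ε, hsq, fun i => ?_⟩
  -- Compare with the sign vector whose `i`-th sign is flipped: the form changes by `4 * M i i - 4 *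
  -- ε i * ∑ j, M i j * ε j`.
  have h := hmax (ε + Pi.single i (-2 * ε i)) fun j => by
    by_cases hj : j = i
    · subst hj
      rcases hε j with h | h
      · norm_num [h]
      · norm_num [Set.mem_singleton_iff.1 h]
    · simpa [Pi.single_eq_of_ne hj] using hε j
  have hcomm : ε ⬝ᵥ (M *ᵥ Pi.single i (-2 * ε i)) = Pi.single i (-2 * ε i) ⬝ᵥ (M *ᵥ ε) := by
    rw [Matrix.dotProduct_mulVec, ← Matrix.mulVec_transpose, hM.eq, dotProduct_comm]
  have hd : Pi.single i (-2 * ε i) ⬝ᵥ (M *ᵥ Pi.single i (-2 * ε i)) = 4 * M i i := by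
    rw [single_dotProduct, Matrix.mulVec_single]
    simp
    linear_combination (4 * M i i) * hsq i
  have hs : Pi.single i (-2 * ε i) ⬝ᵥ (M *ᵥ ε) = -2 * (ε i * ∑ j, M i j * ε j) := by
    rw [single_dotProduct, mul_assoc]
    rfl
  simp only [Matrix.mulVec_add, dotProduct_add, add_dotProduct, hcomm, hd, hs] at h
  linarith

section Rotation

variable {E ι : Type*} [NormedAddCommGroup E] [InnerProductSpace ℝ E] [DecidableEq ι]

/-- Rotation of a family of vectors in the plane of two of its members. -/
noncomputable def rotatePair (u : ι → E) (i j : ι) (t : ℝ) : ι → E :=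
  Function.update (Function.update u i (Real.cos t • u i + Real.sin t • u j)) j
    (Real.cos t • u j - Real.sin t • u i)

theorem Orthonormal.rotatePair {u : ι → E} (hu : Orthonormal ℝ u) {i j : ι} (hij : i ≠ j) (t : ℝ) :
    Orthonormal ℝ (rotatePair u i j t) := by
  have hsc := Real.cos_sq_add_sin_sq t
  have hi : ∀ k, inner ℝ (u k) (u k) = (1 : ℝ) := fun k => by
    rw [real_inner_self_eq_norm_sq, hu.1 k, one_pow]
  have hne : ∀ {k l}, k ≠ l → inner ℝ (u k) (u l) = (0 : ℝ) := fun h => hu.2 h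
  have hji := hij.symm
  rw [orthonormal_iff_ite]
  intro k l
  by_cases hkj : k = j
  · subst hkj
    by_cases hlj : l = k
    · subst hlj
      simp only [_root_.rotatePair, Function.update_self, inner_sub_left, inner_sub_right,
        real_inner_smul_left, real_inner_smul_right, hi, hne hij, hne hji, reduceIte]
      linarith
    · rw [if_neg (Ne.symm hlj)]
      by_cases hli : l = i
      · subst hli
        simp only [_root_.rotatePair, Function.update_self, Function.update_of_ne hij,
          inner_sub_left, inner_add_right, real_inner_smul_left, real_inner_smul_right, hi, hne hij, hne hji]
        ring
      · simp [_root_.rotatePair, hlj, hli, inner_sub_left, real_inner_smul_left,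
          hne (Ne.symm hlj), hne (Ne.symm hli)]
  · by_cases hki : k = i
    · subst hki
      by_cases hlj : l = j
      · subst hlj
        simp only [_root_.rotatePair, Function.update_self, Function.update_of_ne hij,
          inner_add_left, inner_sub_right, real_inner_smul_left, real_inner_smul_right, if_neg hij, hi, hne hij, hne hji]
        ring
      · by_cases hli : l = k
        · subst hli
          simp only [_root_.rotatePair, Function.update_self, Function.update_of_ne hij,
            inner_add_left, inner_add_right, real_inner_smul_left, real_inner_smul_right, hi,
            hne hij, hne hji, reduceIte]
          linarith
        · simp [_root_.rotatePair, hij, hlj, hli, Ne.symm hli, inner_add_left,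
            real_inner_smul_left, hne (Ne.symm hlj), hne (Ne.symm hli)]
    · by_cases hlj : l = j
      · subst hlj
        simp [_root_.rotatePair, hkj, hki, inner_sub_right, real_inner_smul_right, hne hkj,
          hne hki]
      · by_cases hli : l = i
        · subst hli
          simp [_root_.rotatePair, hij, hkj, hki, inner_add_right, real_inner_smul_right, hne hkj,
            hne hki]
        · simpa [_root_.rotatePair, hkj, hki, hlj, hli] using orthonormal_iff_ite.1 hu k l

end Rotation

/-- At a minimizer of the weighted sum of inverse squares of `A i (u i)`, the matrix `A i (u j)`
becomes symmetric after rescaling its rows. -/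
theorem symmetric_of_minimizer {E ι : Type*} [NormedAddCommGroup E] [InnerProductSpace ℝ E]
    [Fintype ι] {A : ι → StrongDual ℝ E} {s : ι → ℝ} {u : ι → E}
    (hu : Orthonormal ℝ u) (h0 : ∀ i, A i (u i) ≠ 0)
    (hmin : ∀ v : ι → E, Orthonormal ℝ v → (∀ i, A i (v i) ≠ 0) →
      ∑ i, (s i / A i (u i)) ^ 2 ≤ ∑ i, (s i / A i (v i)) ^ 2) (i j : ι) :
    s i ^ 2 / A i (u i) ^ 3 * A i (u j) = s j ^ 2 / A j (u j) ^ 3 * A j (u i) := by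
  classical
  rcases eq_or_ne i j with rfl | hij
  · rfl
  -- Rotation by `t` changes only the diagonal values at `i` and `j`, to `p t` and `q t`; the
  -- vanishing derivative at `t = 0` is the claimed symmetry.
  set p : ℝ → ℝ := fun t => A i (u i) * Real.cos t + A i (u j) * Real.sin t with hp
  set q : ℝ → ℝ := fun t => A j (u j) * Real.cos t - A j (u i) * Real.sin t with hq
  have hp' : HasDerivAt p (A i (u j)) 0 := by
    simpa using ((Real.hasDerivAt_cos 0).const_mul (A i (u i))).fun_add
      ((Real.hasDerivAt_sin 0).const_mul (A i (u j)))
  have hq' : HasDerivAt q (-A j (u i)) 0 := by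
    simpa using ((Real.hasDerivAt_cos 0).const_mul (A j (u j))).fun_sub
      ((Real.hasDerivAt_sin 0).const_mul (A j (u i)))
  have hp0 : p 0 = A i (u i) := by simp [hp]
  have hq0 : q 0 = A j (u j) := by simp [hq]
  have hri : ∀ t, A i (rotatePair u i j t i) = p t := fun t => by
    simp [rotatePair, hij, hp, mul_comm]
  have hrj : ∀ t, A j (rotatePair u i j t j) = q t := fun t => by
    simp [rotatePair, hq, mul_comm]
  have hrk : ∀ t k, k ∉ ({i, j} : Finset ι) → rotatePair u i j t k = u k := fun t k hk => by
    simp only [Finset.mem_insert, Finset.mem_singleton, not_or] at hk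
    simp [rotatePair, hk.1, hk.2]
  have hloc : IsLocalMin (fun t => (s i / p t) ^ 2 + (s j / q t) ^ 2) 0 := by
    filter_upwards [hp'.continuousAt.eventually_ne (hp0 ▸ h0 i),
      hq'.continuousAt.eventually_ne (hq0 ▸ h0 j)] with t hpt hqt
    have h := hmin _ (hu.rotatePair hij t) fun k => by
      by_cases hk : k ∈ ({i, j} : Finset ι)
      · simp only [Finset.mem_insert, Finset.mem_singleton] at hk
        rcases hk with rfl | rfl
        · rwa [hri]
        · rwa [hrj]
      · rw [hrk t k hk]
        exact h0 k
    rw [← Finset.sum_add_sum_compl {i, j}, ← Finset.sum_add_sum_compl {i, j} (fun k =>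
      (s k / A k (rotatePair u i j t k)) ^ 2), Finset.sum_pair hij, Finset.sum_pair hij, hri, hrj,
      Finset.sum_congr rfl fun k hk => by rw [← hrk t k (Finset.mem_compl.1 hk)]] at h
    simpa [hp0, hq0] using h
  have hd := hloc.hasDerivAt_eq_zero
    (((hp'.fun_inv (hp0 ▸ h0 i)).const_mul (s i)).pow 2 |>.add
      (((hq'.fun_inv (hq0 ▸ h0 j)).const_mul (s j)).pow 2))
  simp only [hp0, hq0, Nat.cast_ofNat, Nat.add_one_sub_one, pow_one] at hd
  have h1 := h0 i
  have h2 := h0 j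
  field_simp at hd ⊢
  linarith

/-- A form of the **plank theorem** for finitely many functionals on a Euclidean space. -/
theorem exists_mem_ball_le_abs_of_finiteDimensional {E ι : Type*} [NormedAddCommGroup E]
    [InnerProductSpace ℝ E] [FiniteDimensional ℝ E] [Fintype ι] {A : ι → StrongDual ℝ E}
    {b : ι → E} (hb : Orthonormal ℝ b) (hA : ∀ i, A i (b i) = 1) {s : ι → ℝ} (hs : ∀ i, 0 < s i)
    (hs1 : ∑ i, s i ^ 2 ≤ 1) :
    ∃ x : E, ‖x‖ ≤ 1 ∧ ∀ i, s i ≤ |A i x| := by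
  classical
  have hle : ∀ v : ι → E, (∀ i, A i (v i) ≠ 0) → ∑ i, (s i / A i (v i)) ^ 2 ≤ 1 →
      ∀ i, s i ≤ |A i (v i)| := fun v h0 hv i => by
    have h := (Finset.single_le_sum (fun j _ => sq_nonneg (s j / A j (v j)))
      (Finset.mem_univ i)).trans hv
    rw [sq_le_one_iff_abs_le_one, abs_div, abs_of_pos (hs i),
      div_le_one (abs_pos.2 (h0 i))] at h
    exact h
  -- The lower bounds keep the denominators away from 0 and make `K` compact. Families outside `K`
  -- with nonzero diagonal have objective above 1, so a minimizer on `K` is global.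
  set K : Set (ι → E) := {v | Orthonormal ℝ v ∧ ∀ i, s i ≤ |A i (v i)|} with hK
  have hne : ∀ v ∈ K, ∀ i, A i (v i) ≠ 0 := fun v hv i =>
    abs_pos.1 ((hs i).trans_le (hv.2 i))
  have hKc : IsCompact K := by
    refine (isCompact_univ_pi fun _ : ι => isCompact_closedBall (0 : E) 1).of_isClosed_subset ?_ ?_
    · refine IsClosed.inter (s₁ := {v : ι → E | Orthonormal ℝ v})
        (s₂ := {v | ∀ i, s i ≤ |A i (v i)|}) ?_ ?_
      · simp only [orthonormal_iff_ite, Set.ofPred_forall]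
        exact isClosed_iInter fun i => isClosed_iInter fun j =>
          isClosed_eq (by fun_prop) continuous_const
      · simp only [Set.ofPred_forall]
        exact isClosed_iInter fun i => isClosed_le continuous_const (by fun_prop)
    · intro v hv i _
      simp [hv.1.1 i]
  have hbK : b ∈ K := ⟨hb, hle b (by simp [hA]) (by simpa [hA] using hs1)⟩
  obtain ⟨u, huK, hu⟩ := hKc.exists_isMinOn (f := fun v => ∑ i, (s i / A i (v i)) ^ 2) ⟨b, hbK⟩ <|
    continuousOn_finsetSum _ fun i _ => ContinuousOn.pow (continuousOn_const.div
      (by fun_prop) fun v hv => hne v hv i) 2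
  have hu1 : ∑ i, (s i / A i (u i)) ^ 2 ≤ 1 := (hu hbK).trans (by simpa [hA] using hs1)
  have h0 := hne u huK
  have hsymm := symmetric_of_minimizer (s := s) huK.1 h0 fun v hv hv0 => by
    by_cases h : ∑ i, (s i / A i (v i)) ^ 2 ≤ 1
    · exact hu (show v ∈ K from ⟨hv, hle v hv0 h⟩)
    · exact hu1.trans (not_le.1 h).le
  set ν : ι → ℝ := fun i => s i / A i (u i) with hν
  -- With `x = ∑ j, (ε j * ν j) • u j`, the squared norm is the minimal value, at most 1, and Bang's
  -- inequality in row `i` reduces to `s i ≤ ε i * A i x`.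
  obtain ⟨ε, hε, hM⟩ := Matrix.IsSymm.exists_signs_diag_le (M := Matrix.of fun i j =>
      s i ^ 2 / A i (u i) ^ 3 * A i (u j) * ν i * ν j) <| by
    ext i j
    simp only [Matrix.transpose_apply, Matrix.of_apply]
    rw [hsymm i j]
    ring
  refine ⟨∑ j, (ε j * ν j) • u j, ?_, fun i => ?_⟩
  · rw [← sq_le_one_iff₀ (norm_nonneg _), ← real_inner_self_eq_norm_sq, huK.1.inner_sum]
    simpa [← sq, mul_pow, hε] using hu1
  · have h := hM i
    have hsum : ε i * ∑ j, s i ^ 2 / A i (u i) ^ 3 * A i (u j) * ν i * ν j * ε j =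
        s i ^ 2 / A i (u i) ^ 3 * ν i * ε i * A i (∑ j, (ε j * ν j) • u j) := by
      simp only [map_sum, map_smul, smul_eq_mul, Finset.mul_sum]
      exact Finset.sum_congr rfl fun j _ => by ring
    simp only [Matrix.of_apply] at h
    rw [hsum] at h
    have hε1 : |ε i| = 1 := by rw [← Real.sqrt_sq_eq_abs, hε, Real.sqrt_one]
    have hsi := hs i
    have hAi := h0 i
    have hle' : s i ≤ ε i * A i (∑ j, (ε j * ν j) • u j) := by
      refine le_of_mul_le_mul_left ?_ (show 0 < s i ^ 3 / A i (u i) ^ 4 by positivity)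
      have hνi : ν i = s i / A i (u i) := rfl
      rw [hνi] at h
      calc s i ^ 3 / A i (u i) ^ 4 * s i =
            s i ^ 2 / A i (u i) ^ 3 * A i (u i) * (s i / A i (u i)) * (s i / A i (u i)) := by
              field_simp
        _ ≤ _ := h
        _ = _ := by ring
    calc s i ≤ _ := hle'
      _ ≤ |ε i * A i (∑ j, (ε j * ν j) • u j)| := le_abs_self _
      _ = _ := by rw [abs_mul, hε1, one_mul]

/-- A form of the **plank theorem** for finitely many functionals on an inner product space. -/
theorem exists_mem_ball_le_abs_of_finite {E ι : Type*} [NormedAddCommGroup E]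
    [InnerProductSpace ℝ E] [Finite ι] {A : ι → StrongDual ℝ E}
    {b : ι → E} (hb : Orthonormal ℝ b) (hA : ∀ i, A i (b i) = 1) {s : ι → ℝ} (hs : ∀ i, 0 < s i)
    (hs1 : ∀ t : Finset ι, ∑ i ∈ t, s i ^ 2 ≤ 1) :
    ∃ x : E, ‖x‖ ≤ 1 ∧ ∀ i, s i ≤ |A i x| := by
  have := Fintype.ofFinite ι
  let V : Submodule ℝ E := Submodule.span ℝ (Set.range b)
  have : FiniteDimensional ℝ V := FiniteDimensional.span_of_finite ℝ (Set.finite_range b)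
  obtain ⟨x, hx, h⟩ := exists_mem_ball_le_abs_of_finiteDimensional
    (A := fun i => (A i).comp V.subtypeL)
    (b := fun i => (⟨b i, Submodule.subset_span (Set.mem_range_self i)⟩ : V))
    ⟨fun i => hb.1 i, fun i j hij => hb.2 hij⟩ hA hs (hs1 Finset.univ)
  exact ⟨x, hx, h⟩

/-- A form of the **plank theorem** for infinitely many functionals on a Hilbert space. -/
theorem exists_mem_ball_le_abs {E ι : Type*} [NormedAddCommGroup E]
    [InnerProductSpace ℝ E] [CompleteSpace E] {A : ι → StrongDual ℝ E}
    {b : ι → E} (hb : Orthonormal ℝ b) (hA : ∀ i, A i (b i) = 1) {s : ι → ℝ} (hs : ∀ i, 0 < s i)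
    (hs1 : ∀ t : Finset ι, ∑ i ∈ t, s i ^ 2 ≤ 1) :
    ∃ x : E, ∀ i, s i ≤ |A i x| := by
  let a : ι → E := fun i => (InnerProductSpace.toDual ℝ E).symm (A i)
  -- Finite subfamilies have solutions in the unit ball; weak-* compactness gives a common one.
  obtain ⟨f, -, hf⟩ := (WeakDual.isCompact_closedBall (0 : StrongDual ℝ E) 1).inter_iInter_nonempty
    (fun i => {f : WeakDual ℝ E | s i ≤ |f (a i)|})
    (fun i => isClosed_le continuous_const (WeakDual.eval_continuous (a i)).abs) fun t => by
      obtain ⟨x, hx, h⟩ := exists_mem_ball_le_abs_of_finite (ι := t) (A := fun i => A i)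
        (b := fun i => b i) (s := fun i => s i) (hb.comp _ Subtype.val_injective)
        (fun i => hA i) (fun i => hs i) fun r => by
          simpa using hs1 (r.map (Function.Embedding.subtype _))
      refine ⟨StrongDual.toWeakDual (InnerProductSpace.toDual ℝ E x), ?_, ?_⟩
      · simpa using hx
      · simp only [Set.mem_iInter]
        intro i hi
        have h2 : InnerProductSpace.toDual ℝ E x (a i) = A i x := by
          rw [InnerProductSpace.toDual_apply_apply, real_inner_comm,
            InnerProductSpace.toDual_symm_apply]
        change s i ≤ |InnerProductSpace.toDual ℝ E x (a i)|
        rw [h2]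
        exact h ⟨i, hi⟩
  refine ⟨(InnerProductSpace.toDual ℝ E).symm (WeakDual.toStrongDual f), fun i => ?_⟩
  have h2 : A i ((InnerProductSpace.toDual ℝ E).symm (WeakDual.toStrongDual f)) = f (a i) := by
    rw [← InnerProductSpace.toDual_symm_apply, real_inner_comm, InnerProductSpace.toDual_symm_apply]
    rfl
  rw [h2]
  exact Set.mem_iInter.1 hf i

/-- A form of Ball's **plank theorem** for symmetric planks in a Banach space. -/
theorem exists_le_abs_apply {X ι : Type*} [NormedAddCommGroup X] [NormedSpace ℝ X]
    [CompleteSpace X] {φ : ι → StrongDual ℝ X} {x : ι → X} (hφ : ∀ i, φ i (x i) = 1)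
    (hx : ∀ i, ‖x i‖ ≤ 1) {w : ι → ℝ} (hw : ∀ i, 0 < w i) (hws : Summable w)
    (hw1 : ∀ t : Finset ι, ∑ i ∈ t, w i ≤ 1) : ∃ y : X, ∀ i, w i ≤ |φ i y| := by
  classical
  have hsq : ∀ i, √(w i) ^ 2 = w i := fun i => Real.sq_sqrt (hw i).le
  let W : lp (fun _ : ι => ℝ) 2 := ⟨fun i => √(w i), memℓp_gen (by
    simpa [hsq] using hws)⟩
  have hW : ∀ i, W i = √(w i) := fun _ => rfl
  have hpq : ((2 : ENNReal).toReal).HolderConjugate (2 : ENNReal).toReal := by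
    simpa using Real.HolderConjugate.two_two
  have hle : ∀ (f : lp (fun _ : ι => ℝ) 2) i, ‖(W i * f i) • x i‖ ≤ ‖W i‖ * ‖f i‖ := fun f i => by
    rw [norm_smul, norm_mul]
    exact mul_le_of_le_one_right (by positivity) (hx i)
  have hsum : ∀ f : lp (fun _ : ι => ℝ) 2, Summable fun i => (W i * f i) • x i := fun f =>
    .of_norm_bounded (lp.summable_mul hpq W f) (hle f)
  -- Passage to ℓ₂: the `i`-th unit vector goes to `√(w i) • x i`, so the pulled-back functionals,
  -- divided by `√(w i)`, satisfy the Hilbert space version with `s i = √(w i)`.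
  let T : lp (fun _ : ι => ℝ) 2 →L[ℝ] X := LinearMap.mkContinuous
    { toFun := fun f => ∑' i, (W i * f i) • x i
      map_add' := fun f g => by
        rw [← (hsum f).tsum_add (hsum g)]
        exact tsum_congr fun i => by rw [lp.coeFn_add, Pi.add_apply, mul_add, add_smul]
      map_smul' := fun c f => by
        rw [RingHom.id_apply, ← (hsum f).tsum_const_smul c]
        exact tsum_congr fun i => by
          rw [lp.coeFn_smul, Pi.smul_apply, smul_smul, smul_eq_mul, mul_left_comm] }
    ‖W‖ fun f => (tsum_of_norm_bounded (lp.summable_mul hpq W f).hasSum (hle f)).trans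
      (lp.tsum_mul_le_mul_norm' hpq W f)
  have hT : ∀ i, T (lp.single 2 i 1) = √(w i) • x i := fun i => by
    refine (tsum_eq_single i fun j hj => ?_).trans ?_
    · simp [lp.single_apply, Pi.single_eq_of_ne hj]
    · simp [lp.single_apply, hW]
  have hb : Orthonormal ℝ fun i : ι => (lp.single 2 i 1 : lp (fun _ : ι => ℝ) 2) := by
    rw [orthonormal_iff_ite]
    intro i j
    rw [lp.inner_single_left, lp.single_apply, Pi.single_apply]
    split_ifs <;> simp
  obtain ⟨f, hf⟩ := exists_mem_ball_le_abs (A := fun i => (√(w i))⁻¹ • (φ i).comp T) hb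
    (fun i => by
      have := Real.sqrt_ne_zero'.2 (hw i)
      simp [hT, hφ, this]) (s := fun i => √(w i)) (fun i => Real.sqrt_pos.2 (hw i))
    (by simpa [hsq] using hw1)
  refine ⟨T f, fun i => ?_⟩
  have h := hf i
  have hpos := Real.sqrt_pos.2 (hw i)
  simp only [smul_apply, ContinuousLinearMap.comp_apply, smul_eq_mul, abs_mul,
    abs_inv, abs_of_pos hpos] at h
  rw [inv_mul_eq_div, le_div_iff₀ hpos, Real.mul_self_sqrt (hw i).le] at h
  exact h

/-- If `∑ 1 / ‖T i‖` converges, then some vector is bounded away from the kernels of all `T i`. -/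
theorem exists_forall_le_norm_apply {X Y ι : Type*} [NormedAddCommGroup X] [NormedSpace ℝ X]
    [CompleteSpace X] [NormedAddCommGroup Y] [NormedSpace ℝ Y] {T : ι → X →L[ℝ] Y}
    (hT : ∀ i, 0 < ‖T i‖) (hs : Summable fun i => ‖T i‖⁻¹) :
    ∃ y : X, ∃ δ > 0, ∀ i, δ ≤ ‖T i y‖ := by
  choose x hx hTx using fun i => (T i).exists_lt_apply_of_lt_opNorm (half_lt_self (hT i))
  have hpos : ∀ i, 0 < ‖T i (x i)‖ := fun i => (half_pos (hT i)).trans (hTx i)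
  choose g hg hgx using fun i => exists_dual_vector'' ℝ (T i (x i))
  -- The added 1 keeps `C` positive even for an empty index type; dividing by `C` brings the total
  -- width below 1.
  set C := ∑' i, ‖T i‖⁻¹ + 1
  have hC : 0 < C := add_pos_of_nonneg_of_pos (tsum_nonneg fun i => inv_nonneg.2 (hT i).le) one_pos
  obtain ⟨y, hy⟩ := exists_le_abs_apply (φ := fun i => ‖T i (x i)‖⁻¹ • (g i).comp (T i)) (x := x)
    (fun i => by simp [hgx, (hpos i).ne']) (fun i => (hx i).le) (w := fun i => ‖T i‖⁻¹ / C)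
    (fun i => div_pos (inv_pos.2 (hT i)) hC) (hs.div_const C) fun t => by
      rw [← Finset.sum_div, div_le_one hC]
      exact (hs.sum_le_tsum t fun i _ => inv_nonneg.2 (hT i).le).trans (by simp [C])
  refine ⟨y, (2 * C)⁻¹, by positivity, fun i => ?_⟩
  have h1 : |g i (T i y)| ≤ ‖T i y‖ :=
    ((g i).le_opNorm (T i y)).trans (mul_le_of_le_one_left (norm_nonneg _) (hg i))
  have h2 := hy i
  simp only [smul_apply, ContinuousLinearMap.comp_apply, smul_eq_mul, abs_mul,
    abs_inv, abs_norm] at h2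
  rw [inv_mul_eq_div, le_div_iff₀ (hpos i)] at h2
  have hTi := hT i
  calc (2 * C)⁻¹ = ‖T i‖⁻¹ / C * (‖T i‖ / 2) := by field_simp
    _ ≤ ‖T i‖⁻¹ / C * ‖T i (x i)‖ := by gcongr; exact (hTx i).le
    _ ≤ _ := h2.trans h1

/-! ### Necessity of admissibility and the equivalence -/

theorem IsStationaryFor.diff_finite {F : Filter ℕ} (hF : IsFreeFilter F) {I J : Set ℕ}
    (hI : IsStationaryFor F I) (hJ : J.Finite) : IsStationaryFor F (I \ J) := fun A hA => by
  obtain ⟨n, hn, hnA, hnJ⟩ := hI (A ∩ Jᶜ) (inter_mem hA (hF.2 hJ.compl_mem_cofinite))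
  exact ⟨n, ⟨hn, hnJ⟩, hnA⟩

theorem IsFBasis.isAdmissible {X : Type*} [NormedAddCommGroup X] [NormedSpace ℝ X]
    [CompleteSpace X] {F : Filter ℕ} (hF : IsFreeFilter F) {e : ℕ → X} (he : IsFBasis F e)
    {a : ℕ → ℝ} (ha : ∀ n, 0 < a n) (hn : he.HasPartialSumNorms a) : IsAdmissible F 1 a := by
  refine ⟨ha, fun I hI => ?_⟩
  by_contra hfin
  have hs : Summable fun n : I => (a n)⁻¹ := by
    have h := ENNReal.summable_toReal hfin
    refine h.congr fun n => ?_
    rw [Real.rpow_neg_one, ENNReal.toReal_ofReal (inv_nonneg.2 (ha n).le)]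
  -- Discarding these indices leaves `a n ≥ 2`, whence `‖S n - id‖ ≥ a n - 1 ≥ a n / 2`.
  have hJf : {n : ℕ | n ∈ I ∧ a n < 2}.Finite := by
    have h := hs.tendsto_cofinite_zero.eventually (gt_mem_nhds (show (0 : ℝ) < 2⁻¹ by norm_num))
    refine (Filter.eventually_cofinite.1 h |>.image Subtype.val).subset ?_
    rintro n ⟨hnI, hn2⟩
    refine ⟨⟨n, hnI⟩, ?_, rfl⟩
    simpa using inv_anti₀ (ha n) hn2.le
  have hJ := hI.diff_finite hF hJf
  set J := I \ {n : ℕ | n ∈ I ∧ a n < 2} with hJdef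
  have hJ2 : ∀ n : J, 2 ≤ a n := fun n => not_lt.1 fun h => n.2.2 ⟨n.2.1, h⟩
  choose S hS hSn using hn
  have hle : ∀ n : J, a n / 2 ≤ ‖S n - ContinuousLinearMap.id ℝ X‖ := fun n => by
    have h1 := norm_sub_norm_le (S n) (ContinuousLinearMap.id ℝ X)
    have h2 := ContinuousLinearMap.norm_id_le (𝕜 := ℝ) (E := X)
    have h3 := hJ2 n
    rw [hSn] at h1
    linarith
  have hpos : ∀ n : J, 0 < ‖S n - ContinuousLinearMap.id ℝ X‖ := fun n =>
    (half_pos (ha n)).trans_le (hle n)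
  have hsJ : Summable fun n : J => (a n)⁻¹ :=
    hs.comp_injective (Set.inclusion_injective (Set.sdiff_subset : J ⊆ I))
  obtain ⟨y, δ, hδ, hy⟩ := exists_forall_le_norm_apply hpos <|
    (hsJ.mul_left 2).of_nonneg_of_le (fun n => inv_nonneg.2 (hpos n).le) fun n => by
      rw [← div_eq_mul_inv, ← inv_div]
      exact inv_anti₀ (half_pos (ha n)) (hle n)
  obtain ⟨n, hnJ, hnδ⟩ := hJ _ (Metric.tendsto_nhds.1 (he.tendsto_partialSum y) δ hδ)
  have h := hy ⟨n, hnJ⟩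
  simp only [sub_apply, hS, ContinuousLinearMap.id_apply] at h
  rw [← dist_eq_norm] at h
  exact absurd hnδ (not_lt.2 h)

theorem not_finiteDimensional_lp_nat : ¬ FiniteDimensional ℝ (lp (fun _ : ℕ => ℝ) 1) := by
  intro h
  have hli : LinearIndependent ℝ
      fun n : ℕ => (lp.single 1 n 1 : lp (fun _ : ℕ => ℝ) 1) := by
    rw [linearIndependent_iff']
    intro s g hg i hi
    have h := congrArg (lp.evalCLM ℝ (fun _ : ℕ => ℝ) 1 i) hg
    rw [map_sum, map_zero] at h
    have hev : ∀ f : lp (fun _ : ℕ => ℝ) 1, lp.evalCLM ℝ (fun _ : ℕ => ℝ) 1 i f = f i :=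
      fun _ => rfl
    simp only [hev] at h
    simpa [lp.single_apply, Pi.single_apply, hi] using h
  have := hli.finite
  exact not_finite ℕ

theorem mainTheorem2 (F : Filter ℕ) (hF : IsFreeFilter F) (a : ℕ → ℝ) (ha : ∀ n, 1 < a n) :
    List.TFAE
      [∃ (e : ℕ → lp (fun _ : ℕ => ℝ) 1) (he : IsFBasis F e), he.HasPartialSumNorms a,
       ∃ (X : Type u) (_ : NormedAddCommGroup X) (_ : NormedSpace ℝ X),
         CompleteSpace X ∧ ¬ FiniteDimensional ℝ X ∧
           ∃ (e : ℕ → X) (he : IsFBasis F e), he.HasPartialSumNorms a,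
       IsAdmissible F 1 a] := by
  tfae_have 1 → 2 := by
    rintro ⟨e, he, hn⟩
    -- Lifting ℓ₁ places it in the universe of `X`.
    let L : ULift.{u} (lp (fun _ : ℕ => ℝ) 1) ≃ₗᵢ[ℝ] lp (fun _ : ℕ => ℝ) 1 :=
      LinearIsometryEquiv.ulift ℝ _
    exact ⟨ULift.{u} (lp (fun _ : ℕ => ℝ) 1), inferInstance, inferInstance,
      (completeSpace_congr (e := L.toEquiv) L.isometry.isUniformEmbedding).2 inferInstance,
      fun h => not_finiteDimensional_lp_nat (L.toLinearEquiv.finiteDimensional),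
      he.exists_map_hasPartialSumNorms hn L.symm⟩
  tfae_have 2 → 3 := by
    rintro ⟨X, _, _, _, -, e, he, hn⟩
    exact he.isAdmissible hF (fun n => one_pos.trans (ha n)) hn
  tfae_have 3 → 1 := fun h =>
    ⟨_, isFBasis_bidiagonal hF h, hasPartialSumNorms_bidiagonal hF h fun n => (ha n).le⟩
  tfae_finish
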